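/- Let $\mathbb{R}_{\max}=\mathbb{R}\cup\{-\infty\}$ with $a\oplus b=\max\{a,b\}$ and $a\otimes b=a+b$, and let $A$ be an $n\times n$ matrix with entries in $\mathbb{R}_{\max}$. Let $A^{\otimes k}$ ($k\ge 0$) be its max-plus powers, where $(A\otimes B)_{i,j}=\max_h (A_{i,h}+B_{h,j})$ and $A^{\otimes 0}$ has $0$ on the diagonal and $-\infty$ elsewhere. Let $G(A)$ be the digraph on $\{1,\dots,n\}$ with an edge $(i,j)$ of weight $A_{i,j}$ whenever $A_{i,j}\neq-\infty$; $A$ is irreducible if $G(A)$ is strongly connected. A cycle is a closed walk of positive length whose only repeated node is its start node, which is equal to its end node; its mean is its weight (the sum of the weights of its edges) divided by its length. Let $\lambda(A)$ be the largest cycle mean, and $\lambda_2(A)$ the second largest cycle mean, i.e. the largest cycle mean that is strictly smaller than $\lambda(A)$, with $\lambda_2(A)=-\infty$ if there is none. Let $\lVert A\rVert$ be the difference between the greatest and the smallest finite entry of $A$. A sequence $a$ of families of elements of $\mathbb{R}_{\max}$ is eventually periodic with period $p\ge 1$ and ratio $\varrho\in\mathbb{R}$ if there is a $K\in\mathbb{N}=\{0,1,2,\dots\}$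 such that $a(k+p)=a(k)+p\varrho$ component-wise for all $k\ge K$; the smallest such $K$ is the transient of the sequence. **Theorem.** Let $A$ be an irreducible $n\times n$ max-plus matrix. Then the sequence of powers $A^{\otimes k}$ is eventually periodic, and its transient, with respect to every period $p$ and ratio $\varrho$ with which it is eventually periodic, is at most $$2n^2+\frac{2n^2\lVert A\rVert}{\lambda(A)-\lambda_2(A)},$$ where the fraction is read as $0$ if $\lambda_2(A)=-\infty$ (in particular in the degenerate case of the $1\times 1$ matrix $(-\infty)$, which has no cycle). -/

import Mathlib

namespace MaxPlus

/-- An `n × n` max-plus matrix: entries in `ℝ ∪ {-∞}`, with `⊥ = -∞`. -/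
abbrev Mat (n : ℕ) : Type := Matrix (Fin n) (Fin n) (WithBot ℝ)

/-- Max-plus product: `(A ⊗ B) i j = max_h (A i h + B h j)`, the empty maximum being `-∞`. -/
def mul {n : ℕ} (A B : Mat n) : Mat n :=
  fun i j => Finset.univ.sup fun h => A i h + B h j

/-- Max-plus identity matrix: `0` on the diagonal, `-∞` elsewhere. -/
def one (n : ℕ) : Mat n :=
  fun i j => if i = j then 0 else ⊥

/-- The `k`-th max-plus power `A^{⊗ k}`. -/
def pow {n : ℕ} (A : Mat n) : ℕ → Mat n
  | 0 => one n
  | k + 1 => mul (pow A k) A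

/-- The digraph `G(A)`: there is an edge `(i, j)` iff `A i j ≠ -∞`. -/
def digraph {n : ℕ} (A : Mat n) : Digraph (Fin n) where
  Adj i j := A i j ≠ ⊥

/-- `w 0, w 1, …, w ℓ` is a walk of length `ℓ` in the digraph `G`. -/
def IsWalk {V : Type*} (G : Digraph V) {ℓ : ℕ} (w : Fin (ℓ + 1) → V) : Prop :=
  ∀ t : Fin ℓ, G.Adj (w t.castSucc) (w t.succ)

/-- A cycle: a closed walk of positive length in which the only repetition of nodes is that the
start node is equal to the end node. -/
def IsCycle {V : Type*} (G : Digraph V) {ℓ : ℕ} (w : Fin (ℓ + 1) → V) : Prop :=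
  0 < ℓ ∧ IsWalk G w ∧ w 0 = w (Fin.last ℓ) ∧ Function.Injective fun t : Fin ℓ => w t.castSucc

/-- Strong connectivity: there is a (possibly empty) walk from any node to any node. -/
def IsStronglyConnected {V : Type*} (G : Digraph V) : Prop :=
  ∀ i j : V, ∃ (ℓ : ℕ) (w : Fin (ℓ + 1) → V), IsWalk G w ∧ w 0 = i ∧ w (Fin.last ℓ) = j

/-- A max-plus matrix is irreducible if its digraph is strongly connected. -/
def IsIrreducible {n : ℕ} (A : Mat n) : Prop :=
  IsStronglyConnected (digraph A)

/-- The weight `A(W)`: the sum of the weights of the edges of the walk. Only used for walks in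
`G(A)`, where every edge has finite weight, so that the default value `0` never matters. -/
noncomputable def weight {n : ℕ} (A : Mat n) {ℓ : ℕ} (w : Fin (ℓ + 1) → Fin n) : ℝ :=
  ∑ t : Fin ℓ, (A (w t.castSucc) (w t.succ)).unbotD 0

/-- The (finite) set of the cycle means `A(Γ) / ℓ(Γ)`, where `Γ` is a cycle of `G(A)`. -/
def cycleMeans {n : ℕ} (A : Mat n) : Set ℝ :=
  {μ | ∃ (ℓ : ℕ) (w : Fin (ℓ + 1) → Fin n), IsCycle (digraph A) w ∧ μ = weight A w / ℓ}

/-- `λ(A)`, the largest cycle mean; it is `-∞` if there is no cycle. -/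
noncomputable def lam {n : ℕ} (A : Mat n) : EReal :=
  sSup {x : EReal | ∃ μ ∈ cycleMeans A, x = (μ : EReal)}

/-- `λ₂(A)`, the second largest cycle mean, i.e. the largest cycle mean that is strictly smaller
than `λ(A)`; it is `-∞` if there is none. -/
noncomputable def lam₂ {n : ℕ} (A : Mat n) : EReal :=
  sSup {x : EReal | ∃ μ ∈ cycleMeans A, x = (μ : EReal) ∧ x < lam A}

/-- The set of finite entries of `A`. -/
def finiteEntries {n : ℕ} (A : Mat n) : Set ℝ :=
  {x | ∃ i j, A i j = (x : WithBot ℝ)}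

/-- `‖A‖`, the difference between the greatest and the smallest finite entry of `A`. -/
noncomputable def spread {n : ℕ} (A : Mat n) : ℝ :=
  sSup (finiteEntries A) - sInf (finiteEntries A)

/-- The equation `a (k + p) = a k + p * ρ` holds, component-wise, for all `k ≥ K`. -/
def PeriodicFrom {X : Type*} (a : ℕ → X → WithBot ℝ) (p : ℕ) (ρ : ℝ) (K : ℕ) : Prop :=
  ∀ k ≥ K, ∀ x, a (k + p) x = a k x + (((p : ℝ) * ρ : ℝ) : WithBot ℝ)

/-- The sequence `a` is eventually periodic with period `p ≥ 1` and ratio `ρ`. -/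
def EventuallyPeriodic {X : Type*} (a : ℕ → X → WithBot ℝ) (p : ℕ) (ρ : ℝ) : Prop :=
  1 ≤ p ∧ ∃ K : ℕ, PeriodicFrom a p ρ K

/-- The transient of a sequence that is eventually periodic with period `p` and ratio `ρ`:
the smallest `K` such that `a (k + p) = a k + p * ρ` for all `k ≥ K`. -/
noncomputable def transient {X : Type*} (a : ℕ → X → WithBot ℝ) (p : ℕ) (ρ : ℝ) : ℕ :=
  sInf {K : ℕ | PeriodicFrom a p ρ K}

/-- The sequence of max-plus powers of `A`, with index set `Fin n × Fin n`. -/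
def powSeq {n : ℕ} (A : Mat n) : ℕ → Fin n × Fin n → WithBot ℝ :=
  fun k ij => pow A k ij.1 ij.2

end MaxPlus

/-!
A closed walk splits into cycles, so its mean is at most `λ = λ(A)`, and deleting it from a walk
never lowers the weight of the walk relative to `λ` times its length. The period `n!` is a multiple
of the length `l ≤ n` of every critical cycle, i.e. cycle of mean `λ`.

Take a walk through a node `c` on a critical cycle of length `l`. By pigeonhole on the pairs
(node, time modulo `l`), both the part before `c` and the part after `c` can be shortened below
length `n * l` by deleting closed walks whose lengths are multiples of `l`
(`HasWalk.exists_short_modEq`). What is left has length at most `2n² - 2`, and copies of the critical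
cycle fill it up to any length of the right residue class at no loss
(`HasWalk.exists_modEq_of_critical`).

A walk of length `k` that avoids all critical nodes is, up to a path, made of cycles of mean at most
`λ₂(A)`. Hence, compared with `λ * k`, it loses at least `λ(A) - λ₂(A)` per edge outside that path.
What the path may gain and what a detour through a critical node, arranged as above, may lose
amount together to at most `2n²‖A‖`. From the threshold on, the detour is at least as good
(`HasWalk.exists_modEq`), so maximal walks may be taken to meet a critical node, and walks of
lengths `k` and `k + n!` can be exchanged (`pow_add_factorial`). If `λ₂(A) = -∞`, every positive
number may stand for the gap `λ(A) - λ₂(A)`.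

Finally, for an eventually periodic sequence, periodicity from an index on for one period and ratio
implies the same for every other one (`EventuallyPeriodic.periodicFrom`), so the bound for `n!`
suffices.
-/

namespace MaxPlus

/-! ### Walks recorded by length and weight -/

/-- `HasWalk A i j k x`: the digraph of `A` has a walk from `i` to `j` of length `k` and
weight `x`. -/
inductive HasWalk {n : ℕ} (A : Mat n) (i : Fin n) : Fin n → ℕ → ℝ → Prop
  | nil : HasWalk A i i 0 0
  | snoc {j h : Fin n} {k : ℕ} {x a : ℝ} (hw : HasWalk A i j k x) (ha : A j h = (a : WithBot ℝ)) :
      HasWalk A i h (k + 1) (x + a)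

namespace HasWalk

variable {n : ℕ} {A : Mat n} {i j h : Fin n} {k l : ℕ} {x y : ℝ}

theorem append (h₁ : HasWalk A i j k x) (h₂ : HasWalk A j h l y) :
    HasWalk A i h (k + l) (x + y) := by
  induction h₂ with
  | nil => simpa using h₁
  | snoc _ ha ih => rw [← add_assoc, ← add_assoc]; exact ih.snoc ha

theorem repeat_closed (hw : HasWalk A i i k x) (m : ℕ) : HasWalk A i i (m * k) (m * x) := by
  induction m with
  | zero => simpa using HasWalk.nil (A := A) (i := i)
  | succ m ih =>
    have := ih.append hw
    rw [← Nat.succ_mul] at this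
    convert this using 1
    push_cast; ring

theorem weight_eq_zero (hw : HasWalk A i j 0 x) : x = 0 := by
  cases hw; rfl

theorem le_mul_of_entries_le {M : ℝ} (hM : ∀ i j (a : ℝ), A i j = (a : WithBot ℝ) → a ≤ M)
    (hw : HasWalk A i j k x) : x ≤ M * k := by
  induction hw with
  | nil => simp
  | snoc _ ha ih => have := hM _ _ _ ha; push_cast; linarith

theorem mul_le_of_le_entries {m : ℝ} (hm : ∀ i j (a : ℝ), A i j = (a : WithBot ℝ) → m ≤ a)
    (hw : HasWalk A i j k x) : m * k ≤ x := by
  induction hw with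
  | nil => simp
  | snoc _ ha ih => have := hm _ _ _ ha; push_cast; linarith

/-- The nodes `v t` of a walk, together with its partial weights `s t`. -/
theorem exists_trace (hw : HasWalk A i j k x) :
    ∃ (v : ℕ → Fin n) (s : ℕ → ℝ), v 0 = i ∧ v k = j ∧ s 0 = 0 ∧ s k = x ∧
      ∀ t < k, A (v t) (v (t + 1)) = ((s (t + 1) - s t : ℝ) : WithBot ℝ) := by
  induction hw with
  | nil => exact ⟨fun _ => i, fun _ => 0, rfl, rfl, rfl, rfl, by simp⟩
  | @snoc j h k x a hw ha ih =>
    obtain ⟨v, s, h0, hk, hs0, hsk, hs⟩ := ih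
    refine ⟨Function.update v (k + 1) h, Function.update s (k + 1) (x + a), ?_, ?_, ?_, ?_, ?_⟩
    · simpa using h0
    · simp
    · simpa using hs0
    · simp
    · intro t ht
      rcases Nat.lt_succ_iff_lt_or_eq.mp ht with ht | rfl
      · have h₁ : t ≠ k + 1 := by omega
        have h₂ : t + 1 ≠ k + 1 := by omega
        simpa [Function.update_of_ne h₁, Function.update_of_ne h₂] using hs t ht
      · simp [hk, hsk, ha]

theorem of_trace {v : ℕ → Fin n} {s : ℕ → ℝ}
    (hs : ∀ t < k, A (v t) (v (t + 1)) = ((s (t + 1) - s t : ℝ) : WithBot ℝ))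
    {a : ℕ} (d : ℕ) (hd : a + d ≤ k) : HasWalk A (v a) (v (a + d)) d (s (a + d) - s a) := by
  induction d with
  | zero => simpa using HasWalk.nil (A := A) (i := v a)
  | succ d ih =>
    have := (ih (by omega)).snoc (hs (a + d) (by omega))
    rwa [sub_add_sub_cancel', add_assoc] at this

/-- A walk of length at least `n * l` contains a closed walk whose length is a positive multiple
of `l`: by pigeonhole, it visits some node twice at the same time modulo `l`. -/
theorem exists_split (hw : HasWalk A i j k x) (hl : 0 < l) (hk : n * l ≤ k) :
    ∃ (u : Fin n) (k₁ k₂ k₃ : ℕ) (x₁ x₂ x₃ : ℝ), HasWalk A i u k₁ x₁ ∧ HasWalk A u u k₂ x₂ ∧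
      HasWalk A u j k₃ x₃ ∧ 0 < k₂ ∧ l ∣ k₂ ∧ k = k₁ + k₂ + k₃ ∧ x = x₁ + x₂ + x₃ := by
  obtain ⟨v, s, h0, hvk, hs0, hsk, hs⟩ := hw.exists_trace
  obtain ⟨a, b, hab, heq⟩ := Fintype.exists_ne_map_eq_of_card_lt
    (fun t : Fin (k + 1) => (v t, (⟨t % l, Nat.mod_lt _ hl⟩ : Fin l)))
    (by simp only [Fintype.card_prod, Fintype.card_fin]; omega)
  wlog hlt : a < b generalizing a b
  · exact this b a hab.symm heq.symm (lt_of_le_of_ne (not_lt.mp hlt) hab.symm)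
  simp only [Prod.mk.injEq, Fin.mk.injEq] at heq
  obtain ⟨a, ha⟩ := a
  obtain ⟨b, hb⟩ := b
  simp only [Fin.mk_lt_mk] at hlt heq
  obtain ⟨d, rfl⟩ := Nat.exists_eq_add_of_lt hlt
  obtain ⟨e, rfl⟩ := Nat.exists_eq_add_of_le (Nat.lt_succ_iff.mp hb)
  have w₁ := of_trace hs (a := 0) a (by omega)
  have w₂ := of_trace hs (a := a) (d + 1) (by omega)
  have w₃ := of_trace hs (a := a + d + 1) e (by omega)
  rw [zero_add] at w₁
  rw [← add_assoc, ← heq.1] at w₂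
  rw [← heq.1, hvk] at w₃
  rw [h0] at w₁
  refine ⟨v a, a, d + 1, e, _, _, _, w₁, w₂, w₃, by omega, ?_, by omega, ?_⟩
  · have := (Nat.modEq_iff_dvd' (show a ≤ a + d + 1 by omega)).mp heq.2
    rwa [show a + d + 1 - a = d + 1 by omega] at this
  · rw [hsk, hs0]; ring

/-- A bound on the cycle means bounds the mean of every closed walk, since a closed walk splits
into cycles. -/
theorem closed_le {μ : ℝ}
    (hμ : ∀ (l : ℕ) (w : Fin (l + 1) → Fin n), IsCycle (digraph A) w → weight A w ≤ μ * l)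
    (hw : HasWalk A i i k x) : x ≤ μ * k := by
  induction k using Nat.strong_induction_on generalizing i x with
  | _ k ih =>
    rcases Nat.eq_zero_or_pos k with rfl | hpos
    · simp [hw.weight_eq_zero]
    obtain ⟨v, s, h0, hvk, hs0, hsk, hs⟩ := hw.exists_trace
    by_cases hinj : Function.Injective fun t : Fin k => v t
    · have hc : IsCycle (digraph A) fun t : Fin (k + 1) => v t := by
        refine ⟨hpos, fun t => ?_, ?_, ?_⟩
        · simp [digraph, hs t t.2]
        · simp [h0, hvk]
        · simpa using hinj
      have hweight : weight A (fun t : Fin (k + 1) => v t) = x := by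
        have : ∀ t : Fin k, (A (v (t.castSucc : Fin (k + 1))) (v (t.succ : Fin (k + 1)))).unbotD 0
            = s (t + 1) - s t := fun t => by simp [hs t t.2]
        rw [weight, Finset.sum_congr rfl fun t _ => this t,
          Fin.sum_univ_eq_sum_range (fun t => s (t + 1) - s t), Finset.sum_range_sub, hsk, hs0,
          sub_zero]
      rw [← hweight]
      exact hμ k _ hc
    · obtain ⟨a, b, heq, hab⟩ := Function.not_injective_iff.mp hinj
      wlog hlt : a < b generalizing a b
      · exact this b a heq.symm hab.symm (lt_of_le_of_ne (not_lt.mp hlt) hab.symm)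
      obtain ⟨a, ha⟩ := a
      obtain ⟨b, hb⟩ := b
      simp only [Fin.mk_lt_mk] at hlt heq
      obtain ⟨d, rfl⟩ := Nat.exists_eq_add_of_lt hlt
      obtain ⟨e, rfl⟩ := Nat.exists_eq_add_of_lt hb
      have w₁ := of_trace hs (a := 0) a (by omega)
      have w₂ := of_trace hs (a := a) (d + 1) (by omega)
      have w₃ := of_trace hs (a := a + d + 1) (e + 1) (by omega)
      rw [zero_add] at w₁
      rw [← add_assoc, ← heq] at w₂
      rw [← add_assoc, ← heq, hvk] at w₃
      rw [h0] at w₁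
      have b₁ := ih _ (by omega) (w₁.append w₃)
      have b₂ := ih _ (by omega) w₂
      push_cast at b₁ b₂ ⊢
      linarith

/-- Removing closed walks of lengths divisible by `l` and of mean at most `μ` shortens a walk below
length `n * l`, within its residue class modulo `l`, without lowering its weight relative
to `μ`. -/
theorem exists_short_modEq {μ : ℝ} (hμ : ∀ i k x, HasWalk A i i k x → x ≤ μ * k) (hl : 0 < l)
    (hw : HasWalk A i j k x) :
    ∃ (k' : ℕ) (x' : ℝ), HasWalk A i j k' x' ∧ k' < n * l ∧ k' ≡ k [MOD l] ∧
      x - μ * k ≤ x' - μ * k' := by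
  induction k using Nat.strong_induction_on generalizing x with
  | _ k ih =>
    rcases lt_or_ge k (n * l) with hk | hk
    · exact ⟨k, x, hw, hk, rfl, le_rfl⟩
    obtain ⟨u, k₁, k₂, k₃, x₁, x₂, x₃, w₁, w₂, w₃, hpos, hdvd, rfl, rfl⟩ := hw.exists_split hl hk
    obtain ⟨k', x', w', hk', hmod, hx'⟩ := ih _ (by omega) (w₁.append w₃)
    refine ⟨k', x', w', hk', hmod.trans ?_, ?_⟩
    · rw [show k₁ + k₂ + k₃ = k₁ + k₃ + k₂ by omega]
      exact ((Nat.modEq_zero_iff_dvd.mpr hdvd).add_left (k₁ + k₃)).symm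
    · have := hμ _ _ _ w₂
      push_cast at hx' ⊢
      linarith

/-- If all entries are at most `M` and all closed walks have mean at most `μ`, a walk consists of a
path of at most `n - 1` edges of weight at most `M` and of edges of mean weight at most `μ`. -/
theorem le_of_closed_le {μ M : ℝ} (hμ : ∀ i k x, HasWalk A i i k x → x ≤ μ * k) (hμM : μ ≤ M)
    (hM : ∀ i j (a : ℝ), A i j = (a : WithBot ℝ) → a ≤ M) (hw : HasWalk A i j k x) :
    x ≤ μ * k + (M - μ) * (n - 1) := by
  obtain ⟨k', x', w', hk', -, hx'⟩ := hw.exists_short_modEq hμ one_pos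
  have h₁ := w'.le_mul_of_entries_le hM
  have h₂ : (k' : ℝ) ≤ n - 1 := by
    have : k' + 1 ≤ n := by omega
    have : (k' : ℝ) + 1 ≤ n := by exact_mod_cast this
    linarith
  have h₃ := mul_le_mul_of_nonneg_left h₂ (sub_nonneg.mpr hμM)
  linarith

end HasWalk

theorem IsWalk.hasWalk {n : ℕ} {A : Mat n} {l : ℕ} {w : Fin (l + 1) → Fin n}
    (hw : IsWalk (digraph A) w) : HasWalk A (w 0) (w (Fin.last l)) l (weight A w) := by
  induction l with
  | zero => simpa [weight] using HasWalk.nil (A := A) (i := w 0)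
  | succ l ih =>
    have h₁ := ih (w := fun t => w t.castSucc) fun t => hw t.castSucc
    have h₂ : A (w (Fin.last l).castSucc) (w (Fin.last l).succ) =
        (((A (w (Fin.last l).castSucc) (w (Fin.last l).succ)).unbotD 0 : ℝ) : WithBot ℝ) := by
      obtain ⟨a, ha⟩ := WithBot.ne_bot_iff_exists.mp (hw (Fin.last l))
      rw [← ha]; rfl
    have h₃ := h₁.snoc h₂
    rw [weight, Fin.sum_univ_castSucc]
    exact h₃

theorem IsCycle.hasWalk {n : ℕ} {A : Mat n} {l : ℕ} {w : Fin (l + 1) → Fin n}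
    (hw : IsCycle (digraph A) w) : HasWalk A (w 0) (w 0) l (weight A w) := by
  have := hw.2.1.hasWalk
  rwa [← hw.2.2.1] at this

theorem IsCycle.length_le {n : ℕ} {G : Digraph (Fin n)} {l : ℕ} {w : Fin (l + 1) → Fin n}
    (hw : IsCycle G w) : l ≤ n := by
  simpa using Fintype.card_le_of_injective _ hw.2.2.2

/-! ### Max-plus powers as maximal walk weights -/

theorem HasWalk.le_pow {n : ℕ} {A : Mat n} {i j : Fin n} {k : ℕ} {x : ℝ}
    (hw : HasWalk A i j k x) : (x : WithBot ℝ) ≤ pow A k i j := by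
  induction hw with
  | nil => simp [pow, one]
  | @snoc j h k x a _ ha ih =>
    calc ((x + a : ℝ) : WithBot ℝ) = (x : WithBot ℝ) + A j h := by rw [ha]; rfl
      _ ≤ pow A k i j + A j h := by gcongr
      _ ≤ _ := Finset.le_sup (f := fun u => pow A k i u + A u h) (Finset.mem_univ j)

theorem hasWalk_of_pow_eq {n : ℕ} {A : Mat n} {i j : Fin n} {k : ℕ} {x : ℝ}
    (hx : pow A k i j = (x : WithBot ℝ)) : HasWalk A i j k x := by
  induction k generalizing j x with
  | zero =>
    by_cases hij : i = j
    · subst hij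
      have : x = 0 := by simpa [pow, one, eq_comm] using hx
      exact this ▸ .nil
    · simp [pow, one, hij] at hx
  | succ k ih =>
    have : (Finset.univ : Finset (Fin n)).Nonempty := ⟨i, Finset.mem_univ i⟩
    obtain ⟨h, -, hh⟩ := Finset.exists_mem_eq_sup _ this fun h => pow A k i h + A h j
    have hx' : pow A k i h + A h j = (x : WithBot ℝ) := hh.symm.trans hx
    obtain ⟨y, a, hy, ha, rfl⟩ := WithBot.add_eq_coe.mp hx'
    exact (ih hy.symm).snoc ha.symm

theorem pow_le_of_hasWalk {n : ℕ} {A : Mat n} {i j : Fin n} {k : ℕ} {b : WithBot ℝ}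
    (h : ∀ x, HasWalk A i j k x → (x : WithBot ℝ) ≤ b) : pow A k i j ≤ b := by
  rcases eq_or_ne (pow A k i j) ⊥ with hb | hb
  · simp [hb]
  · obtain ⟨x, hx⟩ := WithBot.ne_bot_iff_exists.mp hb
    rw [← hx]
    exact h x (hasWalk_of_pow_eq hx.symm)

/-! ### Critical nodes -/

/-- A node is critical for `μ` if it lies on a closed walk of mean `μ` and of positive length at
most `n`. For `μ = λ(A)` these are the nodes on the cycles of maximal mean. -/
def IsCritical {n : ℕ} (A : Mat n) (μ : ℝ) (c : Fin n) : Prop :=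
  ∃ l : ℕ, 0 < l ∧ l ≤ n ∧ HasWalk A c c l (μ * l)

open Classical in
/-- The matrix of the subgraph induced on the noncritical nodes. -/
noncomputable def noncritical {n : ℕ} (A : Mat n) (μ : ℝ) : Mat n :=
  fun i j => if IsCritical A μ i ∨ IsCritical A μ j then ⊥ else A i j

theorem noncritical_of_ne_bot {n : ℕ} {A : Mat n} {μ : ℝ} {i j : Fin n}
    (h : noncritical A μ i j ≠ ⊥) : ¬ IsCritical A μ i ∧ noncritical A μ i j = A i j := by
  by_cases hc : IsCritical A μ i ∨ IsCritical A μ j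
  · simp [noncritical, hc] at h
  · exact ⟨fun h' => hc (Or.inl h'), by simp [noncritical, hc]⟩

theorem HasWalk.critical_or_noncritical {n : ℕ} {A : Mat n} {i j : Fin n} {k : ℕ} {x : ℝ}
    (hw : HasWalk A i j k x) (μ : ℝ) :
    (∃ (c : Fin n) (k₁ k₂ : ℕ) (x₁ x₂ : ℝ), IsCritical A μ c ∧ HasWalk A i c k₁ x₁ ∧
      HasWalk A c j k₂ x₂ ∧ k = k₁ + k₂ ∧ x = x₁ + x₂) ∨
    (¬ IsCritical A μ j ∧ HasWalk (noncritical A μ) i j k x) := by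
  induction hw with
  | nil =>
    by_cases hi : IsCritical A μ i
    · exact Or.inl ⟨i, 0, 0, 0, 0, hi, .nil, .nil, rfl, by simp⟩
    · exact Or.inr ⟨hi, .nil⟩
  | @snoc j h k x a hw ha ih =>
    rcases ih with ⟨c, k₁, k₂, x₁, x₂, hc, w₁, w₂, rfl, rfl⟩ | ⟨hj, w⟩
    · exact Or.inl ⟨c, k₁, k₂ + 1, x₁, x₂ + a, hc, w₁, w₂.snoc ha, by omega, by ring⟩
    · by_cases hh : IsCritical A μ h
      · exact Or.inl ⟨h, k + 1, 0, x + a, 0, hh, hw.snoc ha, .nil, rfl, by simp⟩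
      · exact Or.inr ⟨hh, w.snoc (by simp [noncritical, hj, hh, ha])⟩

/-- A cycle that avoids the critical nodes does not have mean `μ`, so if a gap `δ` separates `μ`
from the other cycle means, its mean is at most `μ - δ`. -/
theorem noncritical_closed_le {n : ℕ} {A : Mat n} {μ δ : ℝ}
    (hgap : ∀ ν ∈ cycleMeans A, ν = μ ∨ ν ≤ μ - δ) {i : Fin n} {k : ℕ} {x : ℝ}
    (hw : HasWalk (noncritical A μ) i i k x) : x ≤ (μ - δ) * k := by
  refine hw.closed_le fun l w hc => ?_
  have hl : (0 : ℝ) < l := by exact_mod_cast hc.1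
  have hedge : ∀ t : Fin l, noncritical A μ (w t.castSucc) (w t.succ) ≠ ⊥ := hc.2.1
  have hA : IsCycle (digraph A) w := by
    refine ⟨hc.1, fun t => ?_, hc.2.2⟩
    have := hedge t
    rwa [(noncritical_of_ne_bot this).2] at this
  have hweight : weight (noncritical A μ) w = weight A w :=
    Finset.sum_congr rfl fun t _ => by rw [(noncritical_of_ne_bot (hedge t)).2]
  rw [hweight]
  rcases hgap _ ⟨l, w, hA, rfl⟩ with h | h
  · have h₀ : IsCritical A μ (w 0) := by
      refine ⟨l, hc.1, hA.length_le, ?_⟩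
      rw [← h, div_mul_cancel₀ _ hl.ne']
      exact hA.hasWalk
    exact absurd h₀ (noncritical_of_ne_bot (hedge ⟨0, hc.1⟩)).1
  · rwa [div_le_iff₀ hl] at h

/-- A walk through a critical node can be replaced by one of any length `k'` in the same residue
class modulo `n!`, provided `2n² - 2 ≤ k'`: both halves are shortened modulo the length `l` of a
critical closed walk, and copies of the latter are inserted. The second weight bound is by the
number of edges that lie outside the inserted copies. -/
theorem HasWalk.exists_modEq_of_critical {n : ℕ} {A : Mat n} {μ m : ℝ}
    (hμ : ∀ i k x, HasWalk A i i k x → x ≤ μ * k)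
    (hm : ∀ i j (a : ℝ), A i j = (a : WithBot ℝ) → m ≤ a) (hmμ : m ≤ μ)
    {i j c : Fin n} (hc : IsCritical A μ c) {k₁ k₂ k' : ℕ} {x₁ x₂ : ℝ}
    (w₁ : HasWalk A i c k₁ x₁) (w₂ : HasWalk A c j k₂ x₂)
    (hk' : 2 * n ^ 2 ≤ k' + 2) (hmod : k₁ + k₂ ≡ k' [MOD n.factorial]) :
    ∃ x', HasWalk A i j k' x' ∧ x₁ + x₂ - μ * (k₁ + k₂ : ℕ) ≤ x' - μ * k' ∧
      μ * k' - (μ - m) * (2 * n ^ 2) ≤ x' := by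
  obtain ⟨l, hl, hln, wc⟩ := hc
  obtain ⟨a, y₁, v₁, ha, hmod₁, hy₁⟩ := w₁.exists_short_modEq hμ hl
  obtain ⟨b, y₂, v₂, hb, hmod₂, hy₂⟩ := w₂.exists_short_modEq hμ hl
  have hnl : n * l ≤ n ^ 2 := by rw [pow_two]; exact Nat.mul_le_mul_left n hln
  have hab : a + b ≤ k' := by omega
  have hdvd : l ∣ k' - (a + b) :=
    (Nat.modEq_iff_dvd' hab).mp <| (hmod₁.add hmod₂).trans
      (hmod.of_dvd (Nat.dvd_factorial hl hln))
  obtain ⟨q, hq⟩ := hdvd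
  obtain rfl : k' = a + q * l + b := by rw [mul_comm q l]; omega
  refine ⟨_, (v₁.append (wc.repeat_closed q)).append v₂, ?_, ?_⟩
  · push_cast; linarith
  · have h₁ := v₁.mul_le_of_le_entries hm
    have h₂ := v₂.mul_le_of_le_entries hm
    have h₃ : ((a : ℝ) + b) ≤ 2 * n ^ 2 := by
      have : a + b ≤ 2 * n ^ 2 := by omega
      exact_mod_cast this
    have h₄ := mul_le_mul_of_nonneg_left h₃ (sub_nonneg.mpr hmμ)
    push_cast
    linarith

/-- Beyond the threshold, a walk has a counterpart of every length in the same residue class modulo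
`n!` whose weight relative to `μ` is no smaller. A walk that avoids the critical nodes loses at
least `δ` per edge outside a path, and so is beaten by a detour through a critical node. -/
theorem HasWalk.exists_modEq {n : ℕ} {A : Mat n} {μ δ m M : ℝ}
    (hirr : ∀ i j, ∃ k x, HasWalk A i j k x)
    (hμ : ∀ i k x, HasWalk A i i k x → x ≤ μ * k)
    (hδ : 0 < δ) (hgap : ∀ ν ∈ cycleMeans A, ν = μ ∨ ν ≤ μ - δ)
    (hm : ∀ i j (a : ℝ), A i j = (a : WithBot ℝ) → m ≤ a)
    (hM : ∀ i j (a : ℝ), A i j = (a : WithBot ℝ) → a ≤ M)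
    {c : Fin n} (hc : IsCritical A μ c) {i j : Fin n} {k k' : ℕ} {x : ℝ}
    (hw : HasWalk A i j k x) (hmod : k ≡ k' [MOD n.factorial])
    (hk : 2 * n ^ 2 - 1 + 2 * n ^ 2 * (M - m) / δ ≤ (k : ℝ)) (hk' : 2 * n ^ 2 ≤ k' + 2) :
    ∃ x', HasWalk A i j k' x' ∧ x - μ * k ≤ x' - μ * k' := by
  obtain ⟨hmμ, hμM⟩ : m ≤ μ ∧ μ ≤ M := by
    obtain ⟨l, hl, -, wc⟩ := hc
    have hl' : (0 : ℝ) < l := by exact_mod_cast hl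
    exact ⟨le_of_mul_le_mul_right (wc.mul_le_of_le_entries hm) hl',
      le_of_mul_le_mul_right (wc.le_mul_of_entries_le hM) hl'⟩
  rcases hw.critical_or_noncritical μ with ⟨d, k₁, k₂, x₁, x₂, hd, w₁, w₂, rfl, rfl⟩ | ⟨-, w⟩
  · obtain ⟨x', w', hx', -⟩ := HasWalk.exists_modEq_of_critical hμ hm hmμ hd w₁ w₂ hk' hmod
    exact ⟨x', w', hx'⟩
  · -- Prefixing `n!` rounds of a closed walk through `c` keeps the residue class.
    obtain ⟨a, y, wa⟩ := hirr i c
    obtain ⟨b, z, wb⟩ := hirr c i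
    have w₂ := (wb.append ((wa.append wb).repeat_closed (n.factorial - 1))).append hw
    obtain ⟨x', w', -, hx'⟩ := HasWalk.exists_modEq_of_critical hμ hm hmμ hc wa w₂ hk' (by
      refine Nat.ModEq.trans ?_ hmod
      have h₁ : a + (b + (n.factorial - 1) * (a + b) + k) = k + n.factorial * (a + b) := by
        obtain ⟨f, hf⟩ := Nat.exists_eq_succ_of_ne_zero n.factorial_ne_zero
        rw [hf, Nat.succ_sub_one, Nat.succ_mul]; ring
      rw [h₁, Nat.ModEq, Nat.add_mul_mod_self_left])
    refine ⟨x', w', ?_⟩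
    have h₁ := w.le_of_closed_le (μ := μ - δ) (M := M)
      (fun _ _ _ h => noncritical_closed_le hgap h) (by linarith) (fun i j b hb => by
        refine hM i j b ?_
        rw [← hb]
        exact (noncritical_of_ne_bot (by rw [hb]; exact WithBot.coe_ne_bot)).2.symm)
    have hn : (1 : ℝ) ≤ n := by exact_mod_cast c.pos
    have hn₂ : (n : ℝ) ≤ 2 * n ^ 2 := by nlinarith
    have h₂ : 2 * n ^ 2 * (M - m) ≤ δ * (k - (2 * n ^ 2 - 1)) := by
      rw [mul_comm δ, ← div_le_iff₀ hδ]; linarith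
    have h₃ : δ * (k - (2 * n ^ 2 - 1)) ≤ δ * (k - (n - 1)) := by gcongr
    have h₄ : (M - μ) * (n - 1) ≤ (M - μ) * (2 * n ^ 2) := by
      have := sub_nonneg.mpr hμM
      gcongr
      linarith
    linarith

/-! ### Periodicity and transients -/

/-- The period `n!` is a multiple of the length of every critical cycle, so walks of lengths `k` and
`k + n!` can be exchanged for each other. -/
theorem pow_add_factorial {n : ℕ} {A : Mat n} {μ δ m M : ℝ}
    (hirr : ∀ i j, ∃ k x, HasWalk A i j k x)
    (hμ : ∀ i k x, HasWalk A i i k x → x ≤ μ * k)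
    (hδ : 0 < δ) (hgap : ∀ ν ∈ cycleMeans A, ν = μ ∨ ν ≤ μ - δ)
    (hm : ∀ i j (a : ℝ), A i j = (a : WithBot ℝ) → m ≤ a)
    (hM : ∀ i j (a : ℝ), A i j = (a : WithBot ℝ) → a ≤ M) (hmM : m ≤ M)
    {c : Fin n} (hc : IsCritical A μ c) {K : ℕ}
    (hK : 2 * n ^ 2 - 1 + 2 * n ^ 2 * (M - m) / δ ≤ (K : ℝ)) :
    PeriodicFrom (powSeq A) n.factorial μ K := by
  intro k hk ij
  have hk₁ : 2 * n ^ 2 - 1 + 2 * n ^ 2 * (M - m) / δ ≤ (k : ℝ) :=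
    hK.trans (by exact_mod_cast hk)
  have hk₂ : 2 * n ^ 2 ≤ k + 2 := by
    have h₁ : 0 ≤ 2 * n ^ 2 * (M - m) / δ := by
      have := sub_nonneg.mpr hmM
      positivity
    have : (2 * n ^ 2 : ℝ) ≤ k + 2 := by linarith
    exact_mod_cast this
  have hmod : k + n.factorial ≡ k [MOD n.factorial] := by simp [Nat.ModEq]
  have hfac : (0 : ℝ) ≤ n.factorial := by positivity
  show pow A (k + n.factorial) ij.1 ij.2 = pow A k ij.1 ij.2 + _
  apply le_antisymm
  · refine pow_le_of_hasWalk fun x hw => ?_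
    obtain ⟨x', w', hx'⟩ := hw.exists_modEq hirr hμ hδ hgap hm hM hc hmod
      (by push_cast; linarith) hk₂
    calc (x : WithBot ℝ) ≤ ((x' + n.factorial * μ : ℝ) : WithBot ℝ) := by
          rw [WithBot.coe_le_coe]; push_cast at hx'; linarith
      _ ≤ _ := by rw [WithBot.coe_add]; gcongr; exact w'.le_pow
  · rcases eq_or_ne (pow A k ij.1 ij.2) ⊥ with hb | hb
    · simp [hb]
    obtain ⟨x, hx⟩ := WithBot.ne_bot_iff_exists.mp hb
    obtain ⟨x', w', hx'⟩ := (hasWalk_of_pow_eq hx.symm).exists_modEq hirr hμ hδ hgap hm hM hc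
      hmod.symm hk₁ (by omega)
    refine le_trans ?_ w'.le_pow
    rw [← hx, ← WithBot.coe_add, WithBot.coe_le_coe]
    push_cast at hx'
    linarith

theorem PeriodicFrom.mul_period {X : Type*} {a : ℕ → X → WithBot ℝ} {p K : ℕ} {ρ : ℝ}
    (h : PeriodicFrom a p ρ K) (q : ℕ) {k : ℕ} (hk : K ≤ k) (x : X) :
    a (k + q * p) x = a k x + (((q : ℝ) * ((p : ℝ) * ρ) : ℝ) : WithBot ℝ) := by
  induction q with
  | zero => simp
  | succ q ih =>
    rw [Nat.succ_mul, ← add_assoc, h _ (by omega), ih, add_assoc, ← WithBot.coe_add]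
    congr 2
    push_cast; ring

/-- The onset of periodicity does not depend on the period: if `a` is periodic from `K` on for one
period, then so it is for every other, as one sees by moving far enough along the first. -/
theorem EventuallyPeriodic.periodicFrom {X : Type*} {a : ℕ → X → WithBot ℝ} {p P K : ℕ} {ρ μ : ℝ}
    (h : EventuallyPeriodic a p ρ) (hP : 0 < P) (h' : PeriodicFrom a P μ K) :
    PeriodicFrom a p ρ K := by
  obtain ⟨-, L, hL⟩ := h
  intro k hk x
  have hk₁ : L ≤ k + L * P := (Nat.le_mul_of_pos_right L hP).trans (Nat.le_add_left _ _)
  have h₁ := hL _ hk₁ x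
  rw [h'.mul_period L hk, show k + L * P + p = k + p + L * P by ring,
    h'.mul_period L (by omega)] at h₁
  refine WithBot.add_right_cancel WithBot.coe_ne_bot (h₁.trans ?_)
  rw [add_right_comm]

/-! ### Cycle means -/

theorem finite_cycleMeans {n : ℕ} (A : Mat n) : (cycleMeans A).Finite := by
  refine ((Set.finite_Iic n).biUnion fun l _ =>
    Set.finite_range fun w : Fin (l + 1) → Fin n => weight A w / l).subset ?_
  rintro ν ⟨l, w, hw, rfl⟩
  exact Set.mem_biUnion (Set.mem_Iic.mpr hw.length_le) ⟨w, rfl⟩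

theorem finite_finiteEntries {n : ℕ} (A : Mat n) : (finiteEntries A).Finite := by
  refine (Set.finite_range fun ij : Fin n × Fin n => (A ij.1 ij.2).unbotD 0).subset ?_
  rintro a ⟨i, j, h⟩
  exact ⟨(i, j), by simp [h]⟩

/-- A strongly connected digraph without cycles has at most one node, and no edge. -/
theorem periodicFrom_of_cycleMeans_eq_empty {n : ℕ} {A : Mat n}
    (hirr : ∀ i j, ∃ k x, HasWalk A i j k x) (h : cycleMeans A = ∅) (p : ℕ) (ρ : ℝ) :
    PeriodicFrom (powSeq A) p ρ n := by
  have hno : ∀ i k x, HasWalk A i i k x → k = 0 := by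
    intro i k x hw
    by_contra hk
    have hk' : (0 : ℝ) < k := by exact_mod_cast Nat.pos_of_ne_zero hk
    -- In the absence of cycles, every real number bounds the cycle means.
    have := hw.closed_le (μ := x / k - 1) fun l w hc => by
      have : weight A w / l ∈ cycleMeans A := ⟨l, w, hc, rfl⟩
      simp [h] at this
    rw [sub_mul, div_mul_cancel₀ _ hk'.ne'] at this
    linarith
  have hsub : ∀ i j : Fin n, i = j := by
    intro i j
    obtain ⟨k, x, w⟩ := hirr i j
    obtain ⟨k', x', w'⟩ := hirr j i
    have := hno _ _ _ (w.append w')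
    obtain rfl : k = 0 := by omega
    cases w; rfl
  have hbot : ∀ k, 0 < k → ∀ i j, pow A k i j = ⊥ := by
    intro k hk i j
    refine le_bot_iff.mp (pow_le_of_hasWalk fun x hw => ?_)
    rw [hsub j i] at hw
    have := hno _ _ _ hw
    omega
  intro k hk ⟨i, j⟩
  have := i.pos
  simp [powSeq, hbot k (by omega), hbot (k + p) (by omega)]

/-- A gap `δ` below the largest cycle mean bounds the onset of periodicity. The walk argument works
from the real threshold `2n² - 1 + 2n²‖A‖ / δ`, which leaves room for rounding up to `K`. -/
theorem exists_periodicFrom_of_gap {n : ℕ} {A : Mat n} (hirr : ∀ i j, ∃ k x, HasWalk A i j k x)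
    {μ δ : ℝ} (hμ : IsGreatest (cycleMeans A) μ) (hδ : 0 < δ)
    (hgap : ∀ ν ∈ cycleMeans A, ν = μ ∨ ν ≤ μ - δ) :
    ∃ K : ℕ, PeriodicFrom (powSeq A) n.factorial μ K ∧
      (K : ℝ) < 2 * n ^ 2 + 2 * n ^ 2 * spread A / δ := by
  obtain ⟨⟨l, w, hw, hμw⟩, hmax⟩ := hμ
  have hm : ∀ i j (a : ℝ), A i j = (a : WithBot ℝ) → sInf (finiteEntries A) ≤ a := fun i j a h =>
    csInf_le (finite_finiteEntries A).bddBelow ⟨i, j, h⟩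
  have hM : ∀ i j (a : ℝ), A i j = (a : WithBot ℝ) → a ≤ sSup (finiteEntries A) := fun i j a h =>
    le_csSup (finite_finiteEntries A).bddAbove ⟨i, j, h⟩
  have hmM : sInf (finiteEntries A) ≤ sSup (finiteEntries A) :=
    Real.sInf_le_sSup _ (finite_finiteEntries A).bddBelow (finite_finiteEntries A).bddAbove
  have hclosed : ∀ i k x, HasWalk A i i k x → x ≤ μ * k := fun i k x h =>
    h.closed_le fun l w hc => by
      rw [← div_le_iff₀ (by exact_mod_cast hc.1)]
      exact hmax ⟨l, w, hc, rfl⟩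
  have hc : IsCritical A μ (w 0) := by
    have hl : (l : ℝ) ≠ 0 := by exact_mod_cast hw.1.ne'
    refine ⟨l, hw.1, hw.length_le, ?_⟩
    rw [hμw, div_mul_cancel₀ _ hl]
    exact hw.hasWalk
  refine ⟨⌈(2 * n ^ 2 - 1 + 2 * n ^ 2 * spread A / δ : ℝ)⌉₊,
    pow_add_factorial hirr hclosed hδ hgap hm hM hmM hc (Nat.le_ceil _), ?_⟩
  have hn : (1 : ℝ) ≤ n := by exact_mod_cast (w 0).pos
  have hs : 0 ≤ 2 * n ^ 2 * spread A / δ := by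
    have : 0 ≤ spread A := sub_nonneg.mpr hmM
    positivity
  have := Nat.ceil_lt_add_one (a := (2 * n ^ 2 - 1 + 2 * n ^ 2 * spread A / δ : ℝ))
    (by nlinarith)
  linarith

end MaxPlus

/-- The sequence of max-plus powers of an irreducible matrix is eventually periodic, and its
transient (with respect to any period and ratio) is at most
`2n² + 2n²‖A‖ / (λ(A) - λ₂(A))`. The bound is computed in the extended reals: it is `2n²` if
`λ₂(A) = -∞`. -/
theorem mainTheorem1 (n : ℕ) (A : MaxPlus.Mat n) (hA : MaxPlus.IsIrreducible A) :
    (∃ (p : ℕ) (ρ : ℝ), MaxPlus.EventuallyPeriodic (MaxPlus.powSeq A) p ρ) ∧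
    ∀ (p : ℕ) (ρ : ℝ), MaxPlus.EventuallyPeriodic (MaxPlus.powSeq A) p ρ →
      ((MaxPlus.transient (MaxPlus.powSeq A) p ρ : ℝ) : EReal) ≤
        ((2 * (n : ℝ) ^ 2 : ℝ) : EReal) +
          ((2 * (n : ℝ) ^ 2 * MaxPlus.spread A : ℝ) : EReal) /
            (MaxPlus.lam A - MaxPlus.lam₂ A) := by
  have hirr : ∀ i j, ∃ k x, MaxPlus.HasWalk A i j k x := by
    intro i j
    obtain ⟨l, w, hw, rfl, rfl⟩ := hA i j
    exact ⟨l, _, MaxPlus.IsWalk.hasWalk hw⟩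
  have htrans : ∀ {p : ℕ} {ρ : ℝ} {K : ℕ}, MaxPlus.PeriodicFrom (MaxPlus.powSeq A) p ρ K →
      MaxPlus.transient (MaxPlus.powSeq A) p ρ ≤ K := fun h => Nat.sInf_le h
  rcases (MaxPlus.cycleMeans A).eq_empty_or_nonempty with hempty | hne
  · have hper := MaxPlus.periodicFrom_of_cycleMeans_eq_empty hirr hempty
    refine ⟨⟨1, 0, le_rfl, n, hper 1 0⟩, fun p ρ _ => ?_⟩
    have h₁ : (MaxPlus.transient (MaxPlus.powSeq A) p ρ : ℝ) ≤ 2 * (n : ℝ) ^ 2 := by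
      have : n ≤ 2 * n ^ 2 := by nlinarith [Nat.le_mul_self n]
      exact_mod_cast (htrans (hper p ρ)).trans this
    have hlam : MaxPlus.lam A = ⊥ := by simp [MaxPlus.lam, hempty]
    rw [hlam, EReal.bot_sub, EReal.div_bot, add_zero]
    exact_mod_cast h₁
  obtain ⟨μ, hμ, hmax⟩ := (MaxPlus.finite_cycleMeans A).exists_maximal hne
  have hgr : IsGreatest (MaxPlus.cycleMeans A) μ :=
    ⟨hμ, fun ν hν => le_of_not_gt fun h => (hmax hν h.le).not_gt h⟩
  have hlam : MaxPlus.lam A = (μ : EReal) := by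
    refine IsGreatest.csSup_eq ⟨⟨μ, hμ, rfl⟩, ?_⟩
    rintro _ ⟨ν, hν, rfl⟩
    exact_mod_cast hgr.2 hν
  -- A gap `δ` bounds the transient for the period `n!`, hence for every period.
  have hbound : ∀ δ > 0, (∀ ν ∈ MaxPlus.cycleMeans A, ν = μ ∨ ν ≤ μ - δ) → ∀ p ρ,
      MaxPlus.EventuallyPeriodic (MaxPlus.powSeq A) p ρ →
        (MaxPlus.transient (MaxPlus.powSeq A) p ρ : ℝ) <
          2 * (n : ℝ) ^ 2 + 2 * (n : ℝ) ^ 2 * MaxPlus.spread A / δ := by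
    intro δ hδ hgap p ρ hp
    obtain ⟨K, hK, hlt⟩ := MaxPlus.exists_periodicFrom_of_gap hirr hgr hδ hgap
    have h₁ := htrans (hp.periodicFrom n.factorial_pos hK)
    exact lt_of_le_of_lt (by exact_mod_cast h₁) hlt
  have hex : ∀ δ > 0, (∀ ν ∈ MaxPlus.cycleMeans A, ν = μ ∨ ν ≤ μ - δ) →
      ∃ (p : ℕ) (ρ : ℝ), MaxPlus.EventuallyPeriodic (MaxPlus.powSeq A) p ρ := by
    intro δ hδ hgap
    obtain ⟨K, hK, -⟩ := MaxPlus.exists_periodicFrom_of_gap hirr hgr hδ hgap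
    exact ⟨_, _, n.factorial_pos, K, hK⟩
  rcases (MaxPlus.cycleMeans A ∩ Set.Iio μ).eq_empty_or_nonempty with hempty | hne₂
  · have hgap : ∀ δ : ℝ, ∀ ν ∈ MaxPlus.cycleMeans A, ν = μ ∨ ν ≤ μ - δ := by
      intro δ ν hν
      refine Or.inl ((hgr.2 hν).eq_of_not_lt fun h => ?_)
      exact (Set.eq_empty_iff_forall_notMem.mp hempty) ν ⟨hν, h⟩
    refine ⟨hex 1 one_pos (hgap 1), fun p ρ hp => ?_⟩
    have hlam₂ : MaxPlus.lam₂ A = ⊥ := by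
      refine sSup_eq_bot.mpr ?_
      rintro _ ⟨ν, hν, rfl, hlt⟩
      rw [hlam, EReal.coe_lt_coe_iff] at hlt
      exact ((Set.eq_empty_iff_forall_notMem.mp hempty) ν ⟨hν, hlt⟩).elim
    rw [hlam, hlam₂, EReal.coe_sub_bot, EReal.div_top, add_zero]
    -- Every `δ` is a gap; a large one makes the fraction smaller than `1`, and `2n²` is an integer.
    set s := 2 * (n : ℝ) ^ 2 * MaxPlus.spread A
    have hδ : 0 < |s| + 1 := by positivity
    have h₁ := hbound (|s| + 1) hδ (hgap _) p ρ hp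
    have h₂ : s / (|s| + 1) < 1 := by
      rw [div_lt_one hδ]; linarith [le_abs_self s]
    have h₃ : (MaxPlus.transient (MaxPlus.powSeq A) p ρ : ℝ) < 2 * (n : ℝ) ^ 2 + 1 := by linarith
    have h₄ : MaxPlus.transient (MaxPlus.powSeq A) p ρ < 2 * n ^ 2 + 1 := by exact_mod_cast h₃
    have h₅ : (MaxPlus.transient (MaxPlus.powSeq A) p ρ : ℝ) ≤ 2 * (n : ℝ) ^ 2 := by
      exact_mod_cast Nat.lt_succ_iff.mp h₄
    exact_mod_cast h₅
  · obtain ⟨ν, ⟨hν, hνμ⟩, hmax₂⟩ :=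
      ((MaxPlus.finite_cycleMeans A).inter_of_left (Set.Iio μ)).exists_maximal hne₂
    have hle : ∀ κ ∈ MaxPlus.cycleMeans A, κ < μ → κ ≤ ν := fun κ hκ hlt =>
      le_of_not_gt fun h => (hmax₂ ⟨hκ, hlt⟩ h.le).not_gt h
    have hlam₂ : MaxPlus.lam₂ A = (ν : EReal) := by
      refine IsGreatest.csSup_eq ⟨⟨ν, hν, rfl, ?_⟩, ?_⟩
      · rw [hlam]; exact_mod_cast hνμ
      · rintro _ ⟨κ, hκ, rfl, hlt⟩
        rw [hlam, EReal.coe_lt_coe_iff] at hlt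
        exact_mod_cast hle κ hκ hlt
    have hgap : ∀ κ ∈ MaxPlus.cycleMeans A, κ = μ ∨ κ ≤ μ - (μ - ν) := by
      intro κ hκ
      rcases (hgr.2 hκ).eq_or_lt with h | h
      · exact Or.inl h
      · exact Or.inr (by linarith [hle κ hκ h])
    have hδ : 0 < μ - ν := sub_pos.mpr hνμ
    refine ⟨hex _ hδ hgap, fun p ρ hp => ?_⟩
    rw [hlam, hlam₂, ← EReal.coe_sub, ← EReal.coe_div, ← EReal.coe_add, EReal.coe_le_coe_iff]
    exact (hbound _ hδ hgap p ρ hp).le
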